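/- **Theorem 5.** Let $P$ be the two-way infinite path, i.e. the graph with vertex set $\mathbb{Z}$ in which two integers are adjacent if and only if they differ by $1$. Let $(\square P)^3=P\,\square\,P\,\square\,P$ be the 3-dimensional grid, where $G\,\square\,H$ denotes the Cartesian product of graphs: the vertex set is $V(G)\times V(H)$, and $(g,h)$, $(g',h')$ are adjacent if and only if $g=g'$ and $hh'\in E(H)$, or $h=h'$ and $gg'\in E(G)$. A vertex coloring $c$ of a graph $G$ is called non-repetitive if $G$ contains no path $v_1,\dots,v_{2k}$ (with $k\ge 1$ and pairwise distinct vertices) such that $c(v_i)=c(v_{k+i})$ for all $1\le i\le k$; and $\pi(G)$ denotes the minimum number of colors in a non-repetitive coloring of $G$. Then $$\pi\big((\square P)^3\big)\le 28 .$$ -/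

import Mathlib

namespace NonrepetitiveColoring

/-- A walk `v₁, …, v₂ₖ` is repetitive under the vertex coloring `c` if it has an even number `2k` of
vertices and `c vᵢ = c vₖ₊ᵢ` for all `1 ≤ i ≤ k` (written here with indices starting at `0`).
A walk has at least one vertex, so `k ≥ 1` holds automatically. -/
def IsRepetitive {V C : Type*} {G : SimpleGraph V} (c : V → C) {u v : V} (p : G.Walk u v) : Prop :=
  ∃ k : ℕ, p.support.length = 2 * k ∧ ∀ i < k, c (p.getVert i) = c (p.getVert (k + i))

/-- A vertex coloring of `G` is non-repetitive if `G` contains no repetitive path. -/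
def IsNonrepetitive {V C : Type*} (G : SimpleGraph V) (c : V → C) : Prop :=
  ∀ ⦃u v : V⦄ (p : G.Walk u v), p.IsPath → ¬ IsRepetitive c p

/-- The non-repetitive chromatic number (Thue number) `π(G)`: the minimum number of colors of a
non-repetitive coloring of `G`, and `⊤` if no finite number of colors suffices. -/
noncomputable def thueNumber {V : Type*} (G : SimpleGraph V) : ℕ∞ :=
  ⨅ n ∈ {n : ℕ | ∃ c : V → Fin n, IsNonrepetitive G c}, (n : ℕ∞)

/-- The two-way infinite path `P` on `ℤ`: two integers are adjacent iff they are consecutive. -/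
noncomputable def infinitePath : SimpleGraph ℤ := SimpleGraph.hasse ℤ

/-- The 3-dimensional grid: the Cartesian product of three copies of the infinite path. -/
noncomputable def grid3 : SimpleGraph ((ℤ × ℤ) × ℤ) :=
  (infinitePath.boxProd infinitePath).boxProd infinitePath

end NonrepetitiveColoring

namespace NonrepetitiveColoring

/-! Color v by `leeForm` modulo 7 and by the sum of b over the coordinates modulo 4, where b has
increments `letterSeq`: 7 · 4 = 28 colors. On a repetitive path the first color makes both halves
take the same steps, so the second half is the first translated by some t ≠ 0. By the second color,
the differences b(v_j + t_j) - b(v_j) sum to 0 along the first half; a step moves one coordinate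
only, so each difference is constant. Hence, if |t_j| ≥ 2, `letterSeq` has a factor of length 2|t_j|
- 1 with period |t_j|, contrary to `letterSeq_no_almost_square`. So all |t_j| ≤ 1, and `leeForm t =
0` makes every t_j = ±1. The first step of the path then contradicts either the shape of t or the
distinctness of adjacent letters. -/

/-! ### A sequence on four letters without almost-squares -/

/-- The images of the four letters under a `16`-uniform morphism. -/
def block : Fin 4 → List (Fin 4) :=
  ![[0, 1, 3, 2, 1, 0, 2, 3, 0, 1, 2, 0, 3, 1, 2, 3],
    [0, 1, 3, 2, 1, 0, 2, 3, 0, 1, 2, 3, 1, 0, 3, 2],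
    [0, 1, 3, 2, 1, 0, 2, 3, 1, 2, 0, 3, 1, 0, 2, 3],
    [0, 1, 3, 2, 1, 0, 3, 2, 0, 1, 2, 3, 1, 0, 2, 3]]

/-- The letter at position `r` of the image of the letter `a`. -/
def blockLetter (a : Fin 4) (r : ℕ) : Fin 4 := (block a).getD r 0

/-- The letter at position `k` of the image of the three-letter word `abc`. -/
def tripleLetter (a b c : Fin 4) (k : ℕ) : Fin 4 :=
  if k < 16 then blockLetter a k else if k < 32 then blockLetter b (k - 16)
  else blockLetter c (k - 32)

lemma blockLetter_injective : ∀ a b : Fin 4, a ≠ b →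
    ∃ r < 16, blockLetter a r ≠ blockLetter b r := by
  decide +kernel

lemma tripleLetter_ne_of_near : ∀ a b c : Fin 4, ∀ r < 16,
    tripleLetter a b c r ≠ tripleLetter a b c (r + 1) ∧
    tripleLetter a b c r ≠ tripleLetter a b c (r + 2) := by
  decide +kernel

lemma tripleLetter_short_period : ∀ a b c : Fin 4, a ≠ b → b ≠ c → a ≠ c → ∀ m < 18, 3 ≤ m →
    ∀ r < 16, ∃ j < m - 1, tripleLetter a b c (r + j) ≠ tripleLetter a b c (r + j + m) := by
  decide +kernel

/-- Blocks occur only at block boundaries, so a long repetition has period divisible by 16. The last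
slot is a dummy, since r + o < 32. -/
lemma blockLetter_synchronizing : ∀ o < 16, o ≠ 0 → ∃ r < 16, ∀ a b c : Fin 4,
    blockLetter a r ≠ tripleLetter b c c (r + o) := by
  decide +kernel

/-- The two-sided fixed point of the morphism with the letters `3` and `0` around the origin. -/
def letterSeq (n : ℤ) : Fin 4 :=
  if n = 0 then 0 else if n = -1 then 3 else blockLetter (letterSeq (n / 16)) (n % 16).toNat
termination_by n.natAbs
decreasing_by omega

lemma letterSeq_div_mod (n : ℤ) :
    letterSeq n = blockLetter (letterSeq (n / 16)) (n % 16).toNat := by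
  rcases eq_or_ne n 0 with rfl | h0
  · have h : letterSeq 0 = 0 := by rw [letterSeq]; simp
    simp only [Int.zero_ediv, Int.zero_emod, h]
    decide
  rcases eq_or_ne n (-1) with rfl | h1
  · have h : letterSeq (-1) = 3 := by rw [letterSeq]; simp
    have e1 : (-1 : ℤ) / 16 = -1 := by norm_num
    have e2 : ((-1 : ℤ) % 16).toNat = 15 := by decide
    rw [e1, e2, h]
    decide
  · rw [letterSeq, if_neg h0, if_neg h1]

lemma letterSeq_block (q : ℤ) {r : ℕ} (hr : r < 16) :
    letterSeq (16 * q + r) = blockLetter (letterSeq q) r := by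
  rw [letterSeq_div_mod]
  congr 2 <;> omega

lemma letterSeq_triple (q : ℤ) {k : ℕ} (hk : k < 48) :
    letterSeq (16 * q + k) =
      tripleLetter (letterSeq q) (letterSeq (q + 1)) (letterSeq (q + 2)) k := by
  unfold tripleLetter
  split_ifs with h1 h2
  · exact letterSeq_block q h1
  · rw [← letterSeq_block (q + 1) (by omega)]
    congr 1; push_cast [Nat.cast_sub (not_lt.mp h1)]; ring
  · rw [← letterSeq_block (q + 2) (by omega)]
    congr 1; push_cast [Nat.cast_sub (not_lt.mp h2)]; ring

lemma exists_block_position (i : ℤ) : ∃ (q : ℤ) (r : ℕ), r < 16 ∧ i = 16 * q + r :=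
  ⟨i / 16, (i % 16).toNat, by omega, by omega⟩

lemma letterSeq_ne_of_near (i : ℤ) :
    letterSeq i ≠ letterSeq (i + 1) ∧ letterSeq i ≠ letterSeq (i + 2) := by
  obtain ⟨q, r, hr, rfl⟩ := exists_block_position i
  have h := tripleLetter_ne_of_near (letterSeq q) (letterSeq (q + 1)) (letterSeq (q + 2)) r hr
  rw [← letterSeq_triple q (by omega), ← letterSeq_triple q (by omega),
    ← letterSeq_triple q (by omega)] at h
  push_cast at h
  simpa only [add_assoc] using h

/-- No factor of length `2m - 1` of the sequence has period `m`, for `m ≥ 2`. -/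
theorem letterSeq_no_almost_square (m : ℕ) (hm : 2 ≤ m) (i : ℤ) :
    ∃ j : ℕ, j < m - 1 ∧ letterSeq (i + j) ≠ letterSeq (i + j + m) := by
  induction m using Nat.strong_induction_on generalizing i with
  | _ m ih =>
  rcases eq_or_lt_of_le hm with rfl | hm3
  · exact ⟨0, by norm_num, by simpa using (letterSeq_ne_of_near i).2⟩
  obtain ⟨q, r, hr, rfl⟩ := exists_block_position i
  -- For m ≤ 17 the last index r + j + m is at most 47, so three blocks suffice.
  rcases lt_or_ge m 18 with hm18 | hm18
  · have hq := letterSeq_ne_of_near q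
    have hq' := (letterSeq_ne_of_near (q + 1)).1
    rw [add_assoc, one_add_one_eq_two] at hq'
    obtain ⟨j, hj, h⟩ := tripleLetter_short_period _ _ _ hq.1 hq' hq.2 m hm18 hm3 r hr
    rw [← letterSeq_triple q (by omega), ← letterSeq_triple q (by omega)] at h
    push_cast at h
    exact ⟨j, hj, by simpa only [add_assoc] using h⟩
  by_cases hdvd : m % 16 = 0
  · obtain ⟨p, rfl⟩ : ∃ p, m = 16 * p := ⟨m / 16, by omega⟩
    -- Desubstitution: start from the first block that lies entirely at or after the starting
    -- position.
    obtain ⟨j, hj, h⟩ := ih p (by omega) (by omega) (if r = 0 then q else q + 1)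
    obtain ⟨s, hs, h'⟩ := blockLetter_injective _ _ h
    rw [← letterSeq_block _ hs, ← letterSeq_block _ hs] at h'
    split_ifs at h' with h0
    · refine ⟨16 * j + s, by omega, ?_⟩
      subst h0
      convert h' using 2 <;> (push_cast; ring)
    · refine ⟨16 * (j + 1) + s - r, by omega, ?_⟩
      have : ((16 * (j + 1) + s - r : ℕ) : ℤ) = 16 * (j + 1) + s - r := by omega
      rw [this]
      convert h' using 2 <;> (push_cast; ring)
  · obtain ⟨s, hs, h⟩ := blockLetter_synchronizing (m % 16) (by omega) hdvd
    obtain ⟨q', j, hj, hq'⟩ : ∃ (q' : ℤ) (j : ℕ), j < 16 ∧ 16 * q + r + j = 16 * q' + s := by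
      rcases le_or_gt r s with hrs | hrs
      · exact ⟨q, s - r, by omega, by omega⟩
      · exact ⟨q + 1, 16 + s - r, by omega, by omega⟩
    refine ⟨j, by omega, ?_⟩
    have e : 16 * q' + (s : ℤ) + m = 16 * (q' + (m / 16 : ℕ)) + ((s + m % 16 : ℕ) : ℤ) := by
      omega
    rw [hq', e, letterSeq_block _ hs, letterSeq_triple _ (by omega)]
    have h2 := h (letterSeq q') (letterSeq (q' + (m / 16 : ℕ)))
      (letterSeq (q' + (m / 16 : ℕ) + 1))
    unfold tripleLetter at h2 ⊢
    split_ifs at h2 ⊢ with h3 h4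
    · exact h2
    · exact h2
    · omega

/-! ### The coloring of the grid -/

lemma exists_antidifference {A : Type*} [AddCommGroup A] (d : ℤ → A) :
    ∃ b : ℤ → A, ∀ x, b (x + 1) - b x = d x := by
  refine ⟨fun x => ∑ i ∈ Finset.range x.toNat, d i -
    ∑ i ∈ Finset.range (-x).toNat, d (-i - 1), fun x => ?_⟩
  rcases le_or_gt 0 x with hx | hx
  · lift x to ℕ using hx
    have e1 : ((x : ℤ) + 1).toNat = x + 1 := by omega
    have e2 : (-((x : ℤ) + 1)).toNat = 0 := by omega
    have e3 : (-(x : ℤ)).toNat = 0 := by omega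
    simp only [e1, e2, e3, Int.toNat_natCast, Finset.sum_range_succ]
    simp
  · obtain ⟨n, rfl⟩ : ∃ n : ℕ, x = -n - 1 := ⟨(-x - 1).toNat, by omega⟩
    have e1 : (-(n : ℤ) - 1 + 1).toNat = 0 := by omega
    have e2 : (-(-(n : ℤ) - 1 + 1)).toNat = n := by omega
    have e3 : (-(n : ℤ) - 1).toNat = 0 := by omega
    have e4 : (-(-(n : ℤ) - 1)).toNat = n + 1 := by omega
    simp only [e1, e2, e3, e4, Finset.sum_range_succ]
    simp

/-- A walk on the integers visits everything between its ends. -/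
lemma exists_eq_of_between (u : ℕ → ℤ) (n : ℕ) (hu : ∀ i < n, |u (i + 1) - u i| ≤ 1) (y : ℤ)
    (hy : y ∈ Set.uIcc (u 0) (u n)) : ∃ i ≤ n, u i = y := by
  induction n with
  | zero => exact ⟨0, le_rfl, by simpa [eq_comm] using hy⟩
  | succ n ih =>
    by_cases h : y = u (n + 1)
    · exact ⟨n + 1, le_rfl, h.symm⟩
    · have h1 := abs_le.mp (hu n n.lt_succ_self)
      obtain ⟨i, hi, rfl⟩ := ih (fun i hi => hu i (by omega)) (by
        rw [Set.mem_uIcc] at hy ⊢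
        omega)
      exact ⟨i, by omega, rfl⟩

/-- A vertex of the grid as a vector. -/
def toVec (v : (ℤ × ℤ) × ℤ) : Fin 3 → ℤ := ![v.1.1, v.1.2, v.2]

lemma toVec_injective : Function.Injective toVec := by
  rintro ⟨⟨x, y⟩, z⟩ ⟨⟨x', y'⟩, z'⟩ h
  have h0 := congrFun h 0
  have h1 := congrFun h 1
  have h2 := congrFun h 2
  simp_all [toVec]

/-- `w` arises from `v` by moving one unit along a coordinate axis. -/
def IsUnitStep (v w : Fin 3 → ℤ) : Prop :=
  ∃ (j : Fin 3) (s : ℤ), (s = 1 ∨ s = -1) ∧ w = v + Pi.single j s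

lemma infinitePath_adj {x y : ℤ} (h : infinitePath.Adj x y) :
    ∃ s : ℤ, (s = 1 ∨ s = -1) ∧ y = x + s := by
  rw [infinitePath, SimpleGraph.hasse_adj, Order.covBy_iff_add_one_eq,
    Order.covBy_iff_add_one_eq] at h
  exact ⟨y - x, by omega, by omega⟩

lemma isUnitStep_of_adj {v w : (ℤ × ℤ) × ℤ} (h : grid3.Adj v w) :
    IsUnitStep (toVec v) (toVec w) := by
  obtain ⟨⟨x, y⟩, z⟩ := v
  obtain ⟨⟨x', y'⟩, z'⟩ := w
  simp only [grid3, SimpleGraph.boxProd_adj, Prod.mk.injEq] at h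
  rcases h with ⟨⟨h, rfl⟩ | ⟨h, rfl⟩, rfl⟩ | ⟨h, rfl, rfl⟩ <;>
    obtain ⟨s, hs, rfl⟩ := infinitePath_adj h
  · exact ⟨0, s, hs, by ext l; fin_cases l <;> simp [toVec]⟩
  · exact ⟨1, s, hs, by ext l; fin_cases l <;> simp [toVec]⟩
  · exact ⟨2, s, hs, by ext l; fin_cases l <;> simp [toVec]⟩

/-- The linear form `x + 2y + 3z` modulo `7`; it separates the six neighbours of a vertex. -/
def leeForm : (Fin 3 → ℤ) →+ ZMod 7 where
  toFun v := v 0 + 2 * v 1 + 3 * v 2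
  map_zero' := by simp
  map_add' v w := by push_cast [Pi.add_apply]; ring

lemma leeForm_single_injective {j j' : Fin 3} {s s' : ℤ} (hs : s = 1 ∨ s = -1)
    (hs' : s' = 1 ∨ s' = -1) (h : leeForm (Pi.single j s) = leeForm (Pi.single j' s')) :
    (Pi.single j s : Fin 3 → ℤ) = Pi.single j' s' := by
  have key : j = j' ∧ s = s' := by
    rcases hs with rfl | rfl <;> rcases hs' with rfl | rfl <;> fin_cases j <;> fin_cases j' <;>
      revert h <;> decide
  rw [key.1, key.2]

/-- Here |x + 2y + 3z| ≤ 6, so the form vanishes over the integers, which leaves only ±(1, 1, -1).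
-/
lemma abs_eq_one_of_leeForm_eq_zero {t : Fin 3 → ℤ} (ht : t ≠ 0) (hle : ∀ j, |t j| ≤ 1)
    (h : leeForm t = 0) (j : Fin 3) : t j = 1 ∨ t j = -1 := by
  obtain ⟨x, y, z, rfl⟩ : ∃ x y z, t = ![x, y, z] :=
    ⟨t 0, t 1, t 2, by ext l; fin_cases l <;> rfl⟩
  have h0 := abs_le.mp (hle 0)
  have h1 := abs_le.mp (hle 1)
  have h2 := abs_le.mp (hle 2)
  simp only [Matrix.cons_val] at h0 h1 h2
  obtain ⟨a0, b0⟩ := h0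
  obtain ⟨a1, b1⟩ := h1
  obtain ⟨a2, b2⟩ := h2
  clear hle
  interval_cases x <;> interval_cases y <;> interval_cases z <;> revert ht h <;>
    fin_cases j <;> decide

/-- If the increments of `b` form the sequence `letterSeq` and the increment of `b` over distance
`t` is constant between `x` and a point next to `x + t`, then `|t| ≤ 1`. -/
lemma abs_le_one_of_const_increment {b : ℤ → ZMod 4}
    (hb : ∀ x, b (x + 1) - b x = letterSeq x) {x e t : ℤ} (he : |x + t - e| ≤ 1)
    (hconst : ∀ y ∈ Set.uIcc x e, b (y + t) - b y = b (x + t) - b x) : |t| ≤ 1 := by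
  have he' := abs_le.mp he
  have step : ∀ y, y ∈ Set.uIcc x e → y + 1 ∈ Set.uIcc x e →
      letterSeq (y + t) = letterSeq y := by
    intro y hy hy1
    have h := (hconst _ hy1).trans (hconst _ hy).symm
    have h1 := hb (y + t)
    have h2 := hb y
    have h3 : (letterSeq (y + t) : ZMod 4) = letterSeq y := by
      rw [← h1, ← h2, show y + t + 1 = y + 1 + t by ring]
      linear_combination h
    exact h3
  by_contra! hlt
  rcases le_or_gt 0 t with ht | ht
  · rw [abs_of_nonneg ht] at hlt
    lift t to ℕ using ht
    obtain ⟨j, hj, h⟩ := letterSeq_no_almost_square t (by omega) x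
    refine h (step (x + j) ?_ ?_).symm <;> rw [Set.mem_uIcc] <;> omega
  · rw [abs_of_neg ht] at hlt
    obtain ⟨m, rfl⟩ : ∃ m : ℕ, t = -m := ⟨(-t).toNat, by omega⟩
    -- The start is chosen so that the shifted positions, from x - m + 1 on, lie between e and x.
    obtain ⟨j, hj, h⟩ := letterSeq_no_almost_square m (by omega) (x - 2 * m + 1)
    have := step (x - 2 * m + 1 + j + m) (by rw [Set.mem_uIcc]; omega)
      (by rw [Set.mem_uIcc]; omega)
    rw [add_neg_cancel_right] at this
    exact h this

/-- The core of the argument: a path in the grid is not a repetition for the pair of colorings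
`leeForm` and `∑ j, b (v j)`. -/
lemma not_repetition {b : ℤ → ZMod 4} (hb : ∀ x, b (x + 1) - b x = letterSeq x)
    {v : ℕ → Fin 3 → ℤ} {k : ℕ} (hk : 0 < k)
    (hstep : ∀ i, i + 1 < 2 * k → IsUnitStep (v i) (v (i + 1))) (hne : v 0 ≠ v k)
    (hlee : ∀ i < k, leeForm (v i) = leeForm (v (k + i)))
    (hsum : ∀ i < k, ∑ j, b (v i j) = ∑ j, b (v (k + i) j)) : False := by
  set t := v k - v 0 with ht
  have htrans : ∀ i < k, v (k + i) = v i + t := by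
    intro i
    induction i with
    | zero => intro _; simp [ht]
    | succ i ih =>
      intro hi
      obtain ⟨j, s, hs, h⟩ := hstep i (by omega)
      obtain ⟨j', s', hs', h'⟩ := hstep (k + i) (by omega)
      have e := hlee (i + 1) hi
      rw [← add_assoc, h, h', map_add, map_add, hlee i (by omega), add_right_inj] at e
      rw [← add_assoc, h', h, ih (by omega), leeForm_single_injective hs hs' e]
      abel
  have hzero : ∀ i < k, ∑ j, (b (v i j + t j) - b (v i j)) = 0 := by
    intro i hi
    rw [Finset.sum_sub_distrib, hsum i hi, htrans i hi]
    simp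
  have hconst : ∀ j, ∀ i < k, b (v i j + t j) - b (v i j) = b (v 0 j + t j) - b (v 0 j) := by
    intro j i
    induction i with
    | zero => intro _; rfl
    | succ i ih =>
      intro hi
      rw [← ih (by omega)]
      obtain ⟨l, s, hs, h⟩ := hstep i (by omega)
      have hoff : ∀ l', l' ≠ l → v (i + 1) l' = v i l' := by
        intro l' hl'
        rw [h]; simp [hl']
      by_cases hj : j = l
      · subst hj
        -- The other two summands do not change, and the total stays 0, so the moving one is
        -- constant too.
        have e := (hzero (i + 1) hi).trans (hzero i (by omega)).symm
        rw [← Finset.add_sum_erase _ _ (Finset.mem_univ j),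
          ← Finset.add_sum_erase Finset.univ (fun l => b (v i l + t l) - b (v i l))
            (Finset.mem_univ j)] at e
        rw [Finset.sum_congr rfl (g := fun l => b (v i l + t l) - b (v i l))
          (fun l hl => by rw [hoff l (Finset.ne_of_mem_erase hl)])] at e
        exact add_right_cancel e
      · rw [hoff j hj]
  have habs : ∀ j, ∀ i, i + 1 < 2 * k → |v (i + 1) j - v i j| ≤ 1 := by
    intro j i hi
    obtain ⟨l, s, hs, h⟩ := hstep i hi
    rw [h]
    by_cases hj : j = l
    · subst hj
      rcases hs with rfl | rfl <;> simp
    · simp [hj]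
  have htle : ∀ j, |t j| ≤ 1 := by
    intro j
    refine abs_le_one_of_const_increment hb (x := v 0 j) (e := v (k - 1) j) ?_ ?_
    · have := habs j (k - 1) (by omega)
      rw [Nat.sub_add_cancel hk] at this
      simpa [ht] using this
    · intro y hy
      obtain ⟨i, hi, rfl⟩ := exists_eq_of_between (fun i => v i j) (k - 1)
        (fun i hi => habs j i (by omega)) y hy
      exact hconst j i (by omega)
  have htlee : leeForm t = 0 := by
    rw [ht, map_sub, sub_eq_zero]
    simpa using (hlee 0 hk).symm
  have hunit : ∀ j, t j = 1 ∨ t j = -1 :=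
    abs_eq_one_of_leeForm_eq_zero (sub_ne_zero.mpr hne.symm) htle htlee
  obtain ⟨j, s, hs, h⟩ := hstep 0 (by omega)
  rw [zero_add] at h
  rcases eq_or_lt_of_le (Nat.succ_le_of_lt hk) with hk1 | hk1
  · have ht1 : t = Pi.single j s := by
      rw [ht, ← hk1]
      simp [h]
    -- Addition in `Fin 3` is cyclic, so this is a coordinate other than j, where t vanishes.
    have := hunit (j + 1)
    rw [ht1, Pi.single_eq_of_ne (by fin_cases j <;> decide)] at this
    omega
  · have e := hconst j 1 hk1
    rw [h, Pi.add_apply, Pi.single_eq_same] at e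
    have key : ∀ y, b (y + 1 + t j) - b (y + 1) ≠ b (y + t j) - b y := by
      intro y hy
      have h3 : (letterSeq (y + t j) : ZMod 4) = letterSeq y := by
        rw [← hb, ← hb, show y + t j + 1 = y + 1 + t j by ring]
        linear_combination hy
      have h4 : letterSeq (y + t j) = letterSeq y := h3
      rcases hunit j with h1 | h1 <;> rw [h1] at h4
      · exact (letterSeq_ne_of_near y).1 h4.symm
      · have := (letterSeq_ne_of_near (y + -1)).1
        rw [neg_add_cancel_right] at this
        exact this h4
    rcases hs with rfl | rfl
    · exact key _ e
    · refine key (v 0 j + -1) ?_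
      rw [neg_add_cancel_right]
      exact e.symm

theorem exists_isNonrepetitive_grid3 : ∃ c : (ℤ × ℤ) × ℤ → Fin 28, IsNonrepetitive grid3 c := by
  obtain ⟨b, hb⟩ := exists_antidifference (A := ZMod 4) (fun x => letterSeq x)
  have φ : ZMod 7 × ZMod 4 ≃ Fin 28 := Fintype.equivFinOfCardEq (by simp [ZMod.card])
  refine ⟨fun v => φ (leeForm (toVec v), ∑ j, b (toVec v j)), ?_⟩
  rintro u w p hp ⟨k, hlen, hrep⟩
  rw [SimpleGraph.Walk.length_support] at hlen
  have hrep' := fun i hi => Prod.ext_iff.mp (φ.injective (hrep i hi))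
  refine not_repetition hb (v := fun i => toVec (p.getVert i)) (k := k) (by omega) ?_ ?_
    (fun i hi => (hrep' i hi).1) (fun i hi => (hrep' i hi).2)
  · intro i hi
    exact isUnitStep_of_adj (p.adj_getVert_succ (by omega))
  · intro h
    have := hp.getVert_injOn (by simp) (by simp; omega) (toVec_injective h)
    omega

end NonrepetitiveColoring

theorem theorem5 :
    NonrepetitiveColoring.thueNumber NonrepetitiveColoring.grid3 ≤ 28 :=
  iInf₂_le (28 : ℕ) NonrepetitiveColoring.exists_isNonrepetitive_grid3
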